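/- Let $G$ be a finite simple graph with $n$ vertices. In the domination game on $G$, two players, Dominator and Staller, alternately select vertices of $G$, Dominator moving first; each selected vertex $v$ must dominate at least one new vertex, that is, its closed neighborhood $N[v]$ must contain a vertex that is not in the closed neighborhood of any previously selected vertex. The game ends when the selected vertices form a dominating set of $G$. Dominator wants to minimize, and Staller to maximize, the total number of selected vertices. The game domination number $\gamma_g(G)$ is the number of vertices selected when both players play optimally. **Theorem.** If $G$ has diameter exactly $2$, then $$\gamma_g(G) \le \left\lceil \frac{n}{2} \right\rceil - \left\lfloor \frac{n}{11} \right\rfloor .$$ -/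

import Mathlib

/-!
The domination game on a finite simple graph.
A position is a player (who moves next) together with the set `D` of vertices that are already
dominated, i.e. a partially dominated graph `G|D`.
-/

namespace DominationGame

/-- The two players of the domination game. -/
inductive Player where
  | dominator
  | staller

section

variable {V : Type*} [Fintype V]

open Classical in
/-- The closed neighborhood `N[v]`. -/
noncomputable def closedNbhd (G : SimpleGraph V) (v : V) : Finset V :=
  Finset.univ.filter fun w => w = v ∨ G.Adj v w

open Classical in
/-- The legal moves when `D` is the set of dominated vertices: the vertices that dominate
at least one new vertex. -/
noncomputable def legalMoves (G : SimpleGraph V) (D : Finset V) : Finset V :=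
  Finset.univ.filter fun v => ∃ w ∈ closedNbhd G v, w ∉ D

open Classical in
/-- The set of dominated vertices after `v` is played when `D` was dominated. -/
noncomputable def afterMove (G : SimpleGraph V) (D : Finset V) (v : V) : Finset V :=
  D ∪ closedNbhd G v

theorem card_afterMove (G : SimpleGraph V) {D : Finset V} {v : V} (hv : v ∈ legalMoves G D) :
    Fintype.card V - (afterMove G D v).card < Fintype.card V - D.card := by
  classical
  obtain ⟨w, hw, hwD⟩ := (Finset.mem_filter.mp hv).2
  have hlt : D.card < (afterMove G D v).card := by
    apply Finset.card_lt_card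
    refine (Finset.ssubset_iff_of_subset ?_).mpr ⟨w, ?_, hwD⟩
    · intro x hx
      simp [afterMove, hx]
    · simp [afterMove, hw]
  have := Finset.card_le_univ (afterMove G D v)
  omega

/-- There is a legal move exactly as long as some vertex is undominated. -/
theorem legalMoves_nonempty_iff (G : SimpleGraph V) (D : Finset V) :
    (legalMoves G D).Nonempty ↔ D ≠ Finset.univ := by
  classical
  constructor
  · rintro ⟨v, hv⟩ rfl
    obtain ⟨w, -, hw⟩ := (Finset.mem_filter.mp hv).2
    exact hw (Finset.mem_univ w)
  · intro h
    obtain ⟨w, hw⟩ : ∃ w, w ∉ D := by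
      by_contra! hall
      exact h (Finset.eq_univ_iff_forall.mpr hall)
    exact ⟨w, by simp only [legalMoves, closedNbhd, Finset.mem_filter, Finset.mem_univ, true_and]
                 exact ⟨w, Or.inl rfl, hw⟩⟩

open Classical in
/-- The number of moves remaining under optimal play in the game on `G|D` when the given player
has the next move: Dominator minimizes and Staller maximizes the number of moves, and the game
ends when every vertex is dominated (equivalently, when no legal move is left). -/
noncomputable def gameLength (G : SimpleGraph V) (p : Player) (D : Finset V) : ℕ :=
  if h : (legalMoves G D).Nonempty then
    match p with
    | .dominator => 1 + (legalMoves G D).attach.inf' ((Finset.attach_nonempty_iff).mpr h)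
        fun v => gameLength G .staller (afterMove G D v.1)
    | .staller => 1 + (legalMoves G D).attach.sup' ((Finset.attach_nonempty_iff).mpr h)
        fun v => gameLength G .dominator (afterMove G D v.1)
  else 0
termination_by Fintype.card V - D.card
decreasing_by
  · exact card_afterMove G v.2
  · exact card_afterMove G v.2

/-- The game domination number `γ_g(G)`: the number of moves under optimal play when Dominator
starts and no vertex is dominated yet. -/
noncomputable def gameDominationNumber (G : SimpleGraph V) : ℕ :=
  gameLength G .dominator ∅

end

end DominationGame

/-!
Write `n` for the number of vertices, `B = ⌈n/2⌉ - ⌊n/11⌋`, and suppose that `G` has diameter `2`.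

The open neighborhood of any vertex `v` is a dominating set. Dominator can play its vertices one
after the other, so the game ends within `2 deg v - 1` moves
(`gameLength_dominator_le_of_dominating`). This settles the case in which some vertex `v` has
`2 deg v - 1 ≤ B`.

Otherwise every closed neighborhood has at least `c = ⌊(B + 3)/2⌋ + 1 ≥ n/5` vertices, and a greedy
Dominator is fast enough. Suppose that `u` vertices are undominated and at most `m` moves are legal.
Every vertex of the closed neighborhood of an undominated vertex is a legal move, so by double
counting some legal move dominates at least `c u / m` new vertices; by the diameter hypothesis two
undominated vertices have a common dominator, so some legal move dominates at least `min u 2` new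
vertices. The move with the largest gain does both (`exists_legalMove_gain`). Staller's
reply dominates at least one more vertex, and each of the two moves uses up a legal move. Hence the
game ends in time as soon as a purely numerical iteration (`endsWithin`) reaches zero in time
(`gameLength_dominator_le_of_endsWithin`).

The numerical iteration loses three undominated vertices in two moves in general, and six
as long as at least `21` vertices are undominated, because `c ≥ n/5`; this gives the bound `B` for
`n ≥ 100` (`endsWithin_of_add_le`), and smaller `n` are evaluated.
-/

namespace DominationGame

/-! ### The greedy iteration -/

/-- An upper bound for the number of undominated vertices that remain after Dominator's greedy move,
when there were at most `x` of them and at most `m` legal moves, and all closed neighborhoods have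
at least `c` vertices. -/
def greedyRest (c m x : ℕ) : ℕ :=
  min (x - 2) (x * (m - c) / m)

/-- The numerical form of "Dominator, to move and playing greedily, ends the game within `t` moves":
`x` bounds the number of undominated vertices and `m` the number of legal moves. It is Boolean, so
that instances can be evaluated. -/
def endsWithin (c : ℕ) : ℕ → ℕ → ℕ → Bool
  | 0, _, x => x == 0
  | 1, m, x => greedyRest c m x == 0
  | t + 2, m, x => greedyRest c m x == 0 || endsWithin c t (m - 2) (greedyRest c m x - 1)

theorem endsWithin_of_two_mul_lt (c t m x : ℕ) (h : 2 * x + 1 ≤ 3 * t) :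
    endsWithin c t m x = true := by
  induction t using Nat.twoStepInduction generalizing m x with
  | zero => omega
  | one =>
    have h1 : greedyRest c m x ≤ x - 2 := min_le_left _ _
    simp only [endsWithin, beq_iff_eq]
    omega
  | more t ih _ =>
    have h1 : greedyRest c m x ≤ x - 2 := min_le_left _ _
    simp only [endsWithin, Bool.or_eq_true, beq_iff_eq]
    by_cases h0 : greedyRest c m x = 0
    · exact Or.inl h0
    · exact Or.inr (ih _ _ (by omega))

/-- If closed neighborhoods contain at least a fifth of the legal moves, then two moves dominate at
least six new vertices as long as at least `21` vertices are undominated. -/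
theorem endsWithin_of_add_le {c m : ℕ} (t x : ℕ) (hc : m ≤ 5 * c) (h : x + 21 ≤ 3 * t) :
    endsWithin c t m x = true := by
  induction t using Nat.twoStepInduction generalizing m x with
  | zero => omega
  | one => omega
  | more t ih _ =>
    rcases Nat.lt_or_ge 20 x with hx | hx
    · have h1 : 5 * greedyRest c m x ≤ 4 * x := by
        rcases Nat.eq_zero_or_pos m with rfl | hm
        · simp [greedyRest]
        · have h2 : greedyRest c m x ≤ x * (m - c) / m := min_le_right _ _
          have h3 : x * (m - c) / m * m ≤ x * (m - c) := Nat.div_mul_le_self _ _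
          have h4 : 5 * (m - c) ≤ 4 * m := by omega
          have h5 : 5 * (x * (m - c) / m) * m ≤ 4 * x * m := by nlinarith
          have h6 := Nat.le_of_mul_le_mul_right h5 hm
          omega
      simp only [endsWithin, Bool.or_eq_true, beq_iff_eq]
      exact Or.inr (ih _ (by omega) (by omega))
    · exact endsWithin_of_two_mul_lt _ _ _ _ (by omega)

/-- `(n + 1) / 2 - n / 11` is the claimed bound `B`, and `(B + 3) / 2 + 1` is the least size of a closed
neighborhood of a vertex `v` with `B < 2 deg v - 1`. -/
theorem endsWithin_of_lt_hundred : ∀ n < 100, 3 ≤ n →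
    endsWithin (((n + 1) / 2 - n / 11 + 3) / 2 + 1) ((n + 1) / 2 - n / 11) n n = true := by
  decide +kernel

theorem endsWithin_bound (n : ℕ) (hn : 3 ≤ n) :
    endsWithin (((n + 1) / 2 - n / 11 + 3) / 2 + 1) ((n + 1) / 2 - n / 11) n n = true := by
  rcases Nat.lt_or_ge n 100 with h | h
  · exact endsWithin_of_lt_hundred n h hn
  · exact endsWithin_of_add_le _ _ (by omega) (by omega)

/-! ### Moves and game length -/

variable {V : Type*} [Fintype V] {G : SimpleGraph V} {D : Finset V}

theorem mem_closedNbhd {v w : V} : w ∈ closedNbhd G v ↔ w = v ∨ G.Adj v w := by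
  simp [closedNbhd]

theorem mem_closedNbhd_comm {v w : V} : w ∈ closedNbhd G v ↔ v ∈ closedNbhd G w := by
  simp only [mem_closedNbhd, G.adj_comm v w, eq_comm]

theorem mem_legalMoves {v : V} : v ∈ legalMoves G D ↔ ∃ w ∈ closedNbhd G v, w ∉ D := by
  simp [legalMoves]

theorem mem_afterMove {v w : V} : w ∈ afterMove G D v ↔ w ∈ D ∨ w ∈ closedNbhd G v := by
  simp [afterMove]

theorem gameLength_univ (p : Player) : gameLength G p Finset.univ = 0 := by
  rw [gameLength, dif_neg]
  simp [legalMoves_nonempty_iff]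

theorem gameLength_dominator_le {v : V} (hv : v ∈ legalMoves G D) :
    gameLength G .dominator D ≤ 1 + gameLength G .staller (afterMove G D v) := by
  rw [gameLength, dif_pos ⟨v, hv⟩]
  exact Nat.add_le_add_left (Finset.inf'_le
    (fun v : {v // v ∈ legalMoves G D} => gameLength G .staller (afterMove G D v.1))
    (Finset.mem_attach _ ⟨v, hv⟩)) 1

theorem gameLength_staller_le {k : ℕ}
    (h : ∀ v ∈ legalMoves G D, gameLength G .dominator (afterMove G D v) ≤ k) :
    gameLength G .staller D ≤ 1 + k := by
  rw [gameLength]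
  split_ifs with hne
  · exact Nat.add_le_add_left (Finset.sup'_le _ _ fun v _ => h v.1 v.2) 1
  · exact Nat.zero_le _

theorem card_legalMoves_afterMove_lt {v : V} (hv : v ∈ legalMoves G D) :
    (legalMoves G (afterMove G D v)).card < (legalMoves G D).card := by
  refine Finset.card_lt_card ((Finset.ssubset_iff_of_subset fun w hw => ?_).mpr ⟨v, hv, ?_⟩)
  · obtain ⟨x, hx, hxD⟩ := mem_legalMoves.mp hw
    exact mem_legalMoves.mpr ⟨x, hx, fun h => hxD (mem_afterMove.mpr (Or.inl h))⟩
  · rw [mem_legalMoves]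
    rintro ⟨x, hx, hxD⟩
    exact hxD (mem_afterMove.mpr (Or.inr hx))

/-! ### Playing the vertices of a dominating set -/

/-- If the vertices of `S` dominate everything that is still undominated, then Dominator ends the
game within `2 |S| - 1` moves by playing vertices of `S`, skipping those that have become
illegal. -/
theorem gameLength_dominator_le_of_dominating (S : Finset V)
    (hS : ∀ w ∉ D, ∃ s ∈ S, w ∈ closedNbhd G s) :
    gameLength G .dominator D ≤ 2 * S.card - 1 := by
  classical
  induction hk : S.card generalizing S D with
  | zero =>
    have hD : D = Finset.univ := by
      refine Finset.eq_univ_iff_forall.mpr fun w => by_contra fun hw => ?_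
      obtain ⟨s, hs, -⟩ := hS w hw
      simp [Finset.card_eq_zero.mp hk] at hs
    simp [hD, gameLength_univ]
  | succ k ih =>
    by_cases hD : D = Finset.univ
    · simp [hD, gameLength_univ]
    obtain ⟨w, hw⟩ : ∃ w, w ∉ D := by
      simpa [Finset.eq_univ_iff_forall] using hD
    obtain ⟨s, hs, hws⟩ := hS w hw
    refine (gameLength_dominator_le (mem_legalMoves.mpr ⟨w, hws, hw⟩)).trans ?_
    by_cases hD' : afterMove G D s = Finset.univ
    · rw [hD', gameLength_univ]
      omega
    have hrest : ∀ x ∉ afterMove G D s, ∃ r ∈ S.erase s, x ∈ closedNbhd G r := by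
      intro x hx
      rw [mem_afterMove, not_or] at hx
      obtain ⟨r, hr, hxr⟩ := hS x hx.1
      exact ⟨r, Finset.mem_erase.mpr ⟨fun h => hx.2 (h ▸ hxr), hr⟩, hxr⟩
    have hcard : (S.erase s).card = k := by
      rw [Finset.card_erase_of_mem hs, hk, Nat.add_sub_cancel]
    -- The game is not over, so `S.erase s` is nonempty and `2 * k - 1` is not truncated.
    have hk0 : 0 < k := by
      obtain ⟨x, hx⟩ : ∃ x, x ∉ afterMove G D s := by
        simpa [Finset.eq_univ_iff_forall] using hD'
      obtain ⟨r, hr, -⟩ := hrest x hx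
      exact hcard ▸ Finset.card_pos.mpr ⟨r, hr⟩
    have hst : gameLength G .staller (afterMove G D s) ≤ 1 + (2 * k - 1) :=
      gameLength_staller_le fun v _ => ih (S.erase s) (fun x hx =>
        hrest x fun h => hx (mem_afterMove.mpr (Or.inl h))) hcard
    omega

/-! ### Greedy play -/

open Classical in
/-- Double counting of pairs (legal move, undominated vertex that it dominates). -/
theorem sum_gain (G : SimpleGraph V) (D : Finset V) :
    ∑ v ∈ legalMoves G D, (closedNbhd G v \ D).card = ∑ w ∈ Dᶜ, (closedNbhd G w).card := by
  have h := Finset.sum_card_bipartiteAbove_eq_sum_card_bipartiteBelow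
    (s := legalMoves G D) (t := Dᶜ) (fun v w => w ∈ closedNbhd G v)
  convert h using 2 with v hv w hw
  · congr 1
    ext w
    simp [Finset.mem_bipartiteAbove, and_comm]
  · congr 1
    ext v
    rw [Finset.mem_bipartiteBelow, mem_closedNbhd_comm, mem_legalMoves]
    exact ⟨fun h => ⟨⟨w, h, Finset.mem_compl.mp hw⟩, h⟩, fun h => h.2⟩

open Classical in
/-- The legal move with the largest gain dominates at least the average number of new vertices, and
at least two if two undominated vertices are left. -/
theorem exists_legalMove_gain {c : ℕ} (hc : ∀ v, c ≤ (closedNbhd G v).card)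
    (hG : ∀ v w, ∃ x, v ∈ closedNbhd G x ∧ w ∈ closedNbhd G x) (hD : D ≠ Finset.univ) :
    ∃ v ∈ legalMoves G D, Dᶜ.card * c ≤ (legalMoves G D).card * (closedNbhd G v \ D).card ∧
      min Dᶜ.card 2 ≤ (closedNbhd G v \ D).card := by
  obtain ⟨v, hv, hmax⟩ := Finset.exists_max_image (legalMoves G D)
    (fun v => (closedNbhd G v \ D).card) ((legalMoves_nonempty_iff G D).mpr hD)
  refine ⟨v, hv, ?_, ?_⟩
  · calc Dᶜ.card * c ≤ ∑ w ∈ Dᶜ, (closedNbhd G w).card := by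
          simpa using Finset.card_nsmul_le_sum Dᶜ _ c fun w _ => hc w
      _ = ∑ v ∈ legalMoves G D, (closedNbhd G v \ D).card := (sum_gain G D).symm
      _ ≤ (legalMoves G D).card * (closedNbhd G v \ D).card := by
          simpa using Finset.sum_le_card_nsmul _ _ _ hmax
  · rcases Nat.lt_or_ge 1 Dᶜ.card with h | h
    · obtain ⟨a, ha, b, hb, hab⟩ := Finset.one_lt_card.mp h
      rw [Finset.mem_compl] at ha hb
      obtain ⟨x, hax, hbx⟩ := hG a b
      refine (min_le_right _ _).trans (le_trans ?_ (hmax x (mem_legalMoves.mpr ⟨a, hax, ha⟩)))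
      exact Finset.one_lt_card.mpr
        ⟨a, Finset.mem_sdiff.mpr ⟨hax, ha⟩, b, Finset.mem_sdiff.mpr ⟨hbx, hb⟩, hab⟩
    · obtain ⟨w, hw, hwD⟩ := mem_legalMoves.mp hv
      have : 0 < (closedNbhd G v \ D).card :=
        Finset.card_pos.mpr ⟨w, Finset.mem_sdiff.mpr ⟨hw, hwD⟩⟩
      omega

open Classical in
theorem card_compl_afterMove (v : V) :
    (afterMove G D v)ᶜ.card + (closedNbhd G v \ D).card = Dᶜ.card := by
  have h : (afterMove G D v)ᶜ = Dᶜ \ (closedNbhd G v \ D) := by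
    ext w
    simp only [Finset.mem_compl, mem_afterMove, Finset.mem_sdiff]
    tauto
  rw [h]
  exact Finset.card_sdiff_add_card_eq_card fun w hw => by
    simpa using (Finset.mem_sdiff.mp hw).2

open Classical in
theorem exists_legalMove_card_compl_le {c m x : ℕ} (hc : ∀ v, c ≤ (closedNbhd G v).card)
    (hG : ∀ v w, ∃ x, v ∈ closedNbhd G x ∧ w ∈ closedNbhd G x) (hD : D ≠ Finset.univ)
    (hm : (legalMoves G D).card ≤ m) (hx : Dᶜ.card ≤ x) :
    ∃ v ∈ legalMoves G D, (afterMove G D v)ᶜ.card ≤ greedyRest c m x := by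
  obtain ⟨v, hv, h1, h2⟩ := exists_legalMove_gain hc hG hD
  have hadd := card_compl_afterMove (G := G) (D := D) v
  refine ⟨v, hv, le_min (by omega) ?_⟩
  obtain ⟨w, -, hw⟩ := mem_legalMoves.mp hv
  -- All dominators of an undominated vertex are legal, so `m - c` is not truncated.
  have hcm : c ≤ m := by
    refine (hc w).trans (le_trans (Finset.card_le_card fun z hz => ?_) hm)
    exact mem_legalMoves.mpr ⟨w, mem_closedNbhd_comm.mp hz, hw⟩
  have hm0 : 0 < m := (Finset.card_pos.mpr ⟨v, hv⟩).trans_le hm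
  rw [Nat.le_div_iff_mul_le hm0]
  obtain ⟨e, rfl⟩ := Nat.exists_eq_add_of_le hcm
  rw [Nat.add_sub_cancel_left]
  have h3 : Dᶜ.card * c ≤ (c + e) * (closedNbhd G v \ D).card :=
    h1.trans (Nat.mul_le_mul_right _ hm)
  have h4 : Dᶜ.card * e ≤ x * e := Nat.mul_le_mul_right _ hx
  rw [← hadd] at h3 h4
  nlinarith

open Classical in
theorem gameLength_dominator_le_of_endsWithin {c : ℕ} (hc : ∀ v, c ≤ (closedNbhd G v).card)
    (hG : ∀ v w, ∃ x, v ∈ closedNbhd G x ∧ w ∈ closedNbhd G x) {t m x : ℕ}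
    (hm : (legalMoves G D).card ≤ m) (hx : Dᶜ.card ≤ x) (h : endsWithin c t m x = true) :
    gameLength G .dominator D ≤ t := by
  induction t using Nat.twoStepInduction generalizing D m x with
  | zero =>
    have hD : D = Finset.univ := by
      have : x = 0 := by simpa [endsWithin] using h
      rw [← Finset.compl_eq_empty_iff, ← Finset.card_eq_zero]
      omega
    simp [hD, gameLength_univ]
  | one =>
    by_cases hD : D = Finset.univ
    · simp [hD, gameLength_univ]
    obtain ⟨v, hv, hle⟩ := exists_legalMove_card_compl_le hc hG hD hm hx
    have h0 : greedyRest c m x = 0 := by simpa [endsWithin] using h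
    have hu : afterMove G D v = Finset.univ := by
      rw [← Finset.compl_eq_empty_iff, ← Finset.card_eq_zero]
      omega
    simpa [hu, gameLength_univ] using gameLength_dominator_le hv
  | more t ih _ =>
    by_cases hD : D = Finset.univ
    · simp [hD, gameLength_univ]
    obtain ⟨v, hv, hle⟩ := exists_legalMove_card_compl_le hc hG hD hm hx
    have hlegal := card_legalMoves_afterMove_lt hv
    have hst : gameLength G .staller (afterMove G D v) ≤ 1 + t := by
      refine gameLength_staller_le fun w hw => ?_
      have hlegal' := card_legalMoves_afterMove_lt hw
      obtain ⟨z, hz, hzD⟩ := mem_legalMoves.mp hw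
      have hadd := card_compl_afterMove (G := G) (D := afterMove G D v) w
      have hgain : 0 < (closedNbhd G w \ afterMove G D v).card :=
        Finset.card_pos.mpr ⟨z, Finset.mem_sdiff.mpr ⟨hz, hzD⟩⟩
      have h' : endsWithin c t (m - 2) (greedyRest c m x - 1) = true := by
        rcases (by simpa [endsWithin] using h : greedyRest c m x = 0 ∨
          endsWithin c t (m - 2) (greedyRest c m x - 1) = true) with h0 | h0
        · omega
        · exact h0
      exact ih (by omega) (by omega) h'
    have := gameLength_dominator_le hv
    omega

/-! ### Diameter two -/

/-- Any two vertices have a common dominator `x`. Since `x = v` is needed only when `w = v`, the open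
neighborhood of `v` dominates every other vertex. -/
theorem exists_common_dominator (hG : G.diam = 2) (v w : V) :
    ∃ x ∈ closedNbhd G v, v ∈ closedNbhd G x ∧ w ∈ closedNbhd G x ∧ (x = v → w = v) := by
  have hnt : G.ediam ≠ ⊤ := G.ediam_ne_top_of_diam_ne_zero (by omega)
  have hle : G.edist v w ≤ 2 := by
    have h2 : G.ediam = 2 := by
      rw [← ENat.natCast_toNat hnt]
      exact congrArg _ hG
    exact h2 ▸ G.edist_le_ediam
  by_cases hvw : v = w
  · subst hvw
    exact ⟨v, by simp [mem_closedNbhd]⟩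
  by_cases hadj : G.Adj v w
  · exact ⟨w, by simp [mem_closedNbhd, hadj, hadj.symm]⟩
  have hne : (G.commonNeighbors v w).Nonempty := by
    by_contra hempty
    exact absurd hle (not_le.mpr (SimpleGraph.two_lt_edist_iff.mpr
      ⟨hvw, hadj, Set.not_nonempty_iff_eq_empty.mp hempty⟩))
  obtain ⟨x, hx⟩ := hne
  rw [SimpleGraph.mem_commonNeighbors] at hx
  exact ⟨x, by simp [mem_closedNbhd, hx.1],
    by simp [mem_closedNbhd, hx.1.symm], by simp [mem_closedNbhd, hx.2.symm],
    fun h => absurd h hx.1.ne'⟩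

open Classical in
/-- In a graph of diameter two the open neighborhood of any vertex is a dominating set. -/
theorem exists_mem_erase_closedNbhd (hG : G.diam = 2) (v w : V) :
    ∃ s ∈ (closedNbhd G v).erase v, w ∈ closedNbhd G s := by
  have hnt : G.ediam ≠ ⊤ := G.ediam_ne_top_of_diam_ne_zero (by omega)
  have : Nontrivial V := G.nontrivial_of_diam_ne_zero (by omega)
  by_cases hwv : w = v
  · subst hwv
    -- A vertex is dominated by one of its neighbors because `G` is connected and nontrivial.
    obtain ⟨s, hs⟩ := (G.preconnected_of_ediam_ne_top hnt).exists_adj_of_nontrivial w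
    exact ⟨s, by simp [mem_closedNbhd, hs, hs.ne'], by simp [mem_closedNbhd, hs.symm]⟩
  · obtain ⟨s, hs, -, hws, h⟩ := exists_common_dominator hG v w
    exact ⟨s, Finset.mem_erase.mpr ⟨fun hsv => hwv (h hsv), hs⟩, hws⟩

theorem three_le_card_of_diam_eq_two (hG : G.diam = 2) : 3 ≤ Fintype.card V := by
  classical
  have : Nontrivial V := G.nontrivial_of_diam_ne_zero (by omega)
  have hne : G ≠ ⊤ := fun h => by
    have := SimpleGraph.diam_eq_one.mpr h
    omega
  obtain ⟨v, w, hvw, hadj⟩ : ∃ v w, v ≠ w ∧ ¬ G.Adj v w := by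
    by_contra! h
    exact hne (SimpleGraph.ext (by ext v w; exact ⟨fun h => h.ne, h v w⟩))
  obtain ⟨x, hx, -, hwx, h⟩ := exists_common_dominator hG v w
  have hxv : x ≠ v := fun hxv => hvw (h hxv).symm
  have hxw : x ≠ w := by
    rintro rfl
    rcases mem_closedNbhd.mp hx with h | h
    exacts [hxv h, hadj h]
  exact Finset.two_lt_card_iff.mpr ⟨v, w, x, by simp [hvw, hxv.symm, hxw.symm]⟩

theorem gameDominationNumber_le (hG : G.diam = 2) :
    gameDominationNumber G ≤ (Fintype.card V + 1) / 2 - Fintype.card V / 11 := by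
  classical
  have hn := three_le_card_of_diam_eq_two hG
  set n := Fintype.card V with hn_def
  by_cases hc : ∀ v, ((n + 1) / 2 - n / 11 + 3) / 2 + 1 ≤ (closedNbhd G v).card
  · refine gameLength_dominator_le_of_endsWithin hc (fun v w => ?_) (Finset.card_le_univ _)
      (Finset.card_le_univ _) (endsWithin_bound n hn)
    obtain ⟨x, -, hvx, hwx, -⟩ := exists_common_dominator hG v w
    exact ⟨x, hvx, hwx⟩
  · push Not at hc
    obtain ⟨v, hv⟩ := hc
    refine (gameLength_dominator_le_of_dominating ((closedNbhd G v).erase v)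
      fun w _ => exists_mem_erase_closedNbhd hG v w).trans ?_
    rw [Finset.card_erase_of_mem (mem_closedNbhd.mpr (Or.inl rfl))]
    omega

end DominationGame

theorem theorem4p1 {V : Type*} [Fintype V] (G : SimpleGraph V) (hG : G.diam = 2) :
    (DominationGame.gameDominationNumber G : ℤ) ≤
      ⌈(Fintype.card V : ℚ) / 2⌉ - ⌊(Fintype.card V : ℚ) / 11⌋ := by
  have h := DominationGame.gameDominationNumber_le hG
  have hceil : ⌈(Fintype.card V : ℚ) / 2⌉ = -((-(Fintype.card V : ℤ)) / 2) := by
    exact_mod_cast Rat.ceil_natCast_div_natCast (Fintype.card V) 2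
  have hfloor : ⌊(Fintype.card V : ℚ) / 11⌋ = (Fintype.card V : ℤ) / 11 := by
    exact_mod_cast Rat.floor_natCast_div_natCast (Fintype.card V) 11
  rw [hceil, hfloor]
  omega
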